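/- A $p$-string of length $s$ is a valid string of $s$ pairs of parentheses; there are $C_s=\frac1{s+1}\binom{2s}{s}$ of them. For $s\ge 1$, two $p$-strings $P,Q$ of length $s$ generate a $(1,2s-1)$-meander graph, a $4$-valent plane multigraph, as follows. The axis is the segment $[0,2s]$ of the $x$-axis and the vertices are its points $1,\dots,2s-1$. Place the letters of $P$ at the points $1,\dots,2s$ and draw, for each matched pair of parentheses, a semicircle above the axis joining the two corresponding points; place the letters of $Q$ at the points $0,\dots,2s-1$ and draw likewise semicircles below the axis. The edges are the semicircles and the segments $[i,i+1]$, $1\le i\le 2s-2$, of the axis, where the segment $[0,1]$ (respectively $[2s-1,2s]$) is joined to the semicircle ending at $0$ (respectively $2s$) to form a single edge, possibly a loop. Meander graphs are considered as drawn in the plane, so that two of them are equal if and only if they have the same upper and the same lower semicircles. A pierced circle at position $i$, $1\le i\le 2s-2$, is the circle formed by an upper and a lower semicircle which both join the consecutive vertices $i$ and $i+1$. Let $E(s,k)$ be the number of $(1,2s-1)$-meander graphs with exactly $k$ pierced circles. **Proposition.** The ratio of the number of $(1,2s-1)$-meander graphs without any pierced circle to the number of all $(1,2s-1)$-meander graphs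 tends to zero, i.e. $$\frac{E(s,0)}{C_s^2}\longrightarrow 0\qquad\text{as } s\to\infty .$$ -/

import Mathlib

/-- The `i`-th and `j`-th letters (counted from `0`) of the parenthesis string `p` form a matched
pair of parentheses: the string between them is itself a valid parenthesis string. -/
def ParenMatched (p : DyckWord) (i j : ℕ) : Prop :=
  ∃ (l r : List DyckStep) (q : DyckWord),
    p.toList = l ++ q.nest.toList ++ r ∧ i = l.length ∧ j = i + q.toList.length + 1

/-- Labels of the edges of a meander graph, recording how they are drawn in the plane. The axis is
the segment from `0` to `2 * s` of the `x`-axis.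
* `axis i` is the segment of the axis from `i` to `i + 1`.
* `upper a b` contains the semicircle above the axis with ends `a` and `b`.
* `lower a b` contains the semicircle below the axis with ends `a` and `b`. -/
inductive MeanderEdge
  | axis (i : ℕ)
  | upper (a b : ℕ)
  | lower (a b : ℕ)

namespace MeanderEdge

/-- The vertices are the points `1, …, 2 * s - 1` of the axis. The leftmost segment `[0, 1]` and
the rightmost segment `[2 * s - 1, 2 * s]` of the axis belong to the same edge as the semicircle
that ends at `0`, respectively at `2 * s`; so such an edge ends at the vertex `1`, respectively
`2 * s - 1`. -/
def toVertex (s x : ℕ) : ℕ := max 1 (min x (2 * s - 1))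

/-- The unordered pair of the two ends of an edge (they may coincide). -/
def ends (s : ℕ) : MeanderEdge → Sym2 ℕ
  | axis i => s(i, i + 1)
  | upper a b => s(toVertex s a, toVertex s b)
  | lower a b => s(toVertex s a, toVertex s b)

/-- The edges of the meander graph given by two parenthesis strings `P`, `Q` with `s` pairs each:
the letters of `P` are placed at the points `1, …, 2 * s` above the axis and the letters of `Q` at
the points `0, …, 2 * s - 1` below it, and every matched pair gives a semicircle. -/
def IsEdgeOf (s : ℕ) (P Q : DyckWord) : MeanderEdge → Prop
  | axis i => 1 ≤ i ∧ i + 1 < 2 * s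
  | upper a b => ∃ i j, ParenMatched P i j ∧ a = i + 1 ∧ b = j + 1
  | lower a b => ParenMatched Q a b

end MeanderEdge

theorem ParenMatched.semilength_pos {p : DyckWord} {i j : ℕ} (h : ParenMatched p i j) :
    0 < p.semilength := by
  obtain ⟨l, r, q, h, -, -⟩ := h
  have h1 := congrArg List.length h
  have h2 := DyckWord.two_mul_semilength_eq_length (p := q.nest)
  have h3 := DyckWord.two_mul_semilength_eq_length (p := p)
  rw [DyckWord.semilength_nest] at h2
  simp only [List.length_append] at h1
  omega

theorem MeanderEdge.ends_mem {s : ℕ} {P Q : DyckWord} (hP : P.semilength = s)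
    (hQ : Q.semilength = s) {e : MeanderEdge} (he : e.IsEdgeOf s P Q) {x : ℕ}
    (hx : x ∈ e.ends s) : 1 ≤ x ∧ x < 2 * s := by
  cases e with
  | axis i =>
    simp only [MeanderEdge.IsEdgeOf, MeanderEdge.ends, Sym2.mem_iff] at he hx
    omega
  | upper a b =>
    obtain ⟨i, j, h, -, -⟩ := he
    have := h.semilength_pos
    simp only [MeanderEdge.ends, Sym2.mem_iff, MeanderEdge.toVertex] at hx
    omega
  | lower a b =>
    have := ParenMatched.semilength_pos he
    simp only [MeanderEdge.ends, Sym2.mem_iff, MeanderEdge.toVertex] at hx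
    omega

/-- The meander graph generated by two parenthesis strings `P` (upper) and `Q` (lower) with `s`
pairs of parentheses each. -/
def meanderGraph (s : ℕ) (P Q : {p : DyckWord // p.semilength = s}) : Graph ℕ MeanderEdge where
  vertexSet := {x | 1 ≤ x ∧ x < 2 * s}
  IsLink e x y := e.IsEdgeOf s P Q ∧ s(x, y) = e.ends s
  isLink_symm _ _ := ⟨fun _ _ h => ⟨h.1, Sym2.eq_swap.trans h.2⟩⟩
  eq_or_eq_of_isLink_of_isLink _ _ _ _ _ h h' := by
    have := Sym2.eq_iff.1 (h.2.trans h'.2.symm)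
    tauto
  left_mem_of_isLink _ _ _ h :=
    MeanderEdge.ends_mem P.2 Q.2 h.1 (h.2 ▸ Sym2.mem_mk_left _ _)

/-- The set of all `(1, 2 * s - 1)`-meander graphs. -/
def meanderGraphs (s : ℕ) : Set (Graph ℕ MeanderEdge) :=
  {Γ | ∃ P Q, Γ = meanderGraph s P Q}

/-- There is a pierced circle at position `i`: the consecutive vertices `i` and `i + 1` are
joined by a semicircle above the axis and by a semicircle below the axis. -/
def HasPiercedCircleAt (Γ : Graph ℕ MeanderEdge) (i : ℕ) : Prop :=
  Γ.IsLink (.upper i (i + 1)) i (i + 1) ∧ Γ.IsLink (.lower i (i + 1)) i (i + 1)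

/-- The number of pierced circles of a meander graph. -/
noncomputable def numPiercedCircles (Γ : Graph ℕ MeanderEdge) : ℕ :=
  {i | HasPiercedCircleAt Γ i}.ncard

/-- `E(s, k)`, the number of `(1, 2 * s - 1)`-meander graphs with exactly `k` pierced circles. -/
noncomputable def meanderE (s k : ℕ) : ℕ :=
  {Γ ∈ meanderGraphs s | numPiercedCircles Γ = k}.ncard

/-! ### Peaks of Dyck words -/

open DyckStep

/-! The argument is a second moment estimate. Peaks `UD` of `P` at `i` and of `Q` at `i + 1` give a
pierced circle at vertex `i + 1`, for each of `n = 2s - 2` positions. Deleting prescribed peaks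
shows that `C_{s-1}` words have a given peak (`card_isPeak`) and at most `C_{s-2}` have two given
ones (`card_isPeak_and_isPeak_le`). So each position carries a circle with probability
`(C_{s-1}/C_s)^2`, and two positions with probability at most `(C_{s-2}/C_s)^2`. Chebyshev's
inequality (`card_avoiding_mul_le`) bounds the proportion without circles by `(C_s/C_{s-1})^2/n +
(C_s C_{s-2}/C_{s-1}^2)^2 - 1`. As `C_{s+1}/C_s → 4`, this tends to `0 + 1 - 1`: distinct positions
are asymptotically uncorrelated. -/

theorem dyck_prefix_insert_iff (l r : List DyckStep) :
    (∀ k, ((l ++ U :: D :: r).take k).count D ≤ ((l ++ U :: D :: r).take k).count U) ↔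
      ∀ k, ((l ++ r).take k).count D ≤ ((l ++ r).take k).count U := by
  have key (k : ℕ) : (l ++ U :: D :: r).take (l.length + (k + 2)) =
      l ++ U :: D :: r.take k := by
    rw [List.take_length_add_append]; rfl
  have key' (k : ℕ) : (l ++ r).take (l.length + k) = l ++ r.take k :=
    List.take_length_add_append k
  constructor
  · intro h k
    rcases le_or_gt k l.length with hk | hk
    · have := h k
      rwa [List.take_append_of_le_length hk] at this ⊢
    · obtain ⟨m, rfl⟩ := Nat.exists_eq_add_of_lt hk
      have := h (l.length + (m + 1 + 2))
      rw [key] at this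
      rw [add_assoc, key']
      simpa [List.count_append, ← add_assoc] using this
  · intro h k
    rcases le_or_gt k l.length with hk | hk
    · have := h k
      rwa [List.take_append_of_le_length hk] at this ⊢
    · obtain ⟨m, rfl⟩ := Nat.exists_eq_add_of_lt hk
      -- `m = 0` is the prefix cut between the inserted `U` and `D`, the only one with no
      -- counterpart in `l ++ r`.
      rcases m with _ | m
      · have := h l.length
        rw [List.take_left] at this
        rw [add_zero, List.take_length_add_append]
        simp only [List.take_succ_cons, List.take_zero, List.count_append, List.count_cons,
          List.count_nil]
        simp
        omega
      · have := h (l.length + m)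
        rw [key'] at this
        rw [show l.length + (m + 1) + 1 = l.length + (m + 2) by ring, key]
        simpa [List.count_append, ← add_assoc] using this

namespace DyckWord

/-- `p` has an up-step at position `i` immediately followed by a down-step. -/
def IsPeak (p : DyckWord) (i : ℕ) : Prop := p.toList[i]? = some U ∧ p.toList[i + 1]? = some D

theorem IsPeak.toList_eq {p : DyckWord} {i : ℕ} (h : p.IsPeak i) :
    p.toList = p.toList.take i ++ U :: D :: p.toList.drop (i + 2) := by
  obtain ⟨h0, h1⟩ := h
  obtain ⟨hi0, h0⟩ := List.getElem?_eq_some_iff.1 h0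
  obtain ⟨hi1, h1⟩ := List.getElem?_eq_some_iff.1 h1
  conv_lhs => rw [← List.take_append_drop i p.toList, List.drop_eq_getElem_cons hi0,
    List.drop_eq_getElem_cons hi1, h0, h1]

theorem not_isPeak_succ {p : DyckWord} {i : ℕ} (h : p.IsPeak i) : ¬ p.IsPeak (i + 1) := by
  intro h'
  have := h.2.symm.trans h'.1
  simp at this

/-- Remove the two steps of a peak. -/
def erasePeak (p : DyckWord) (i : ℕ) (h : p.IsPeak i) : DyckWord where
  toList := p.toList.take i ++ p.toList.drop (i + 2)
  count_U_eq_count_D := by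
    have := p.count_U_eq_count_D
    rw [h.toList_eq] at this
    simpa [List.count_append, ← add_assoc] using this
  count_D_le_count_U := by
    have := p.count_D_le_count_U
    rw [h.toList_eq] at this
    exact (dyck_prefix_insert_iff _ _).1 this

/-- Insert a peak at position `i`. -/
def insertPeak (p : DyckWord) (i : ℕ) : DyckWord where
  toList := p.toList.take i ++ U :: D :: p.toList.drop i
  count_U_eq_count_D := by
    have := p.count_U_eq_count_D
    rw [← List.take_append_drop i p.toList] at this
    simpa only [List.count_append, List.count_cons, ← add_assoc, reduceCtorEq, BEq.rfl,
      beq_iff_eq, if_true, if_false, add_zero, add_left_inj] using this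
  count_D_le_count_U := by
    refine (dyck_prefix_insert_iff _ _).2 ?_
    rw [List.take_append_drop]
    exact p.count_D_le_count_U

theorem semilength_erasePeak {p : DyckWord} {i : ℕ} (h : p.IsPeak i) :
    (p.erasePeak i h).semilength + 1 = p.semilength := by
  unfold semilength
  conv_rhs => rw [h.toList_eq]
  simp [erasePeak, List.count_append, ← add_assoc]

theorem semilength_insertPeak (p : DyckWord) (i : ℕ) :
    (p.insertPeak i).semilength = p.semilength + 1 := by
  unfold semilength
  conv_rhs => rw [← List.take_append_drop i p.toList]
  simp only [insertPeak, List.count_append, List.count_cons_self]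
  simp [add_assoc]

theorem isPeak_insertPeak {p : DyckWord} {i : ℕ} (hi : i ≤ 2 * p.semilength) :
    (p.insertPeak i).IsPeak i := by
  rw [two_mul_semilength_eq_length] at hi
  have hl : (p.toList.take i).length = i := by simpa using hi
  constructor
  · simp only [insertPeak]
    rw [List.getElem?_append_right (by omega), hl]
    simp
  · simp only [insertPeak]
    rw [List.getElem?_append_right (by omega), hl]
    simp

theorem insertPeak_erasePeak {p : DyckWord} {i : ℕ} (h : p.IsPeak i) :
    (p.erasePeak i h).insertPeak i = p := by
  have hil := (List.getElem?_eq_some_iff.1 h.1).1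
  have hl : (p.toList.take i).length = i := by simp; omega
  refine DyckWord.ext ?_
  conv_rhs => rw [h.toList_eq]
  simp only [insertPeak, erasePeak]
  rw [List.take_left' hl, List.drop_left' hl]

theorem insertPeak_injective {p q : DyckWord} {i : ℕ} (hs : p.semilength = q.semilength)
    (h : p.insertPeak i = q.insertPeak i) : p = q := by
  have h := congrArg toList h
  simp only [insertPeak] at h
  have hpl := two_mul_semilength_eq_length (p := p)
  have hql := two_mul_semilength_eq_length (p := q)
  obtain ⟨h1, h2⟩ := List.append_inj h (by simp; omega)
  simp only [List.cons.injEq, true_and] at h2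
  ext1
  rw [← List.take_append_drop i p.toList, h1, h2, List.take_append_drop]

theorem IsPeak.erasePeak {p : DyckWord} {i j : ℕ} (hi : p.IsPeak i) (hj : p.IsPeak j)
    (hij : i + 2 ≤ j) : (p.erasePeak j hj).IsPeak i := by
  have hjl := (List.getElem?_eq_some_iff.1 hj.1).1
  constructor
  · simp only [DyckWord.erasePeak]
    rw [List.getElem?_append_left (by simp; omega), List.getElem?_take_of_lt (by omega)]
    exact hi.1
  · simp only [DyckWord.erasePeak]
    rw [List.getElem?_append_left (by simp; omega), List.getElem?_take_of_lt (by omega)]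
    exact hi.2

open scoped Classical in
/-- The number of Dyck words of semilength `s` with prescribed peak is independent of the
position of the peak. -/
theorem card_isPeak {s i : ℕ} (hi : i ≤ 2 * s) :
    (Finset.univ.filter fun p : {p : DyckWord // p.semilength = s + 1} => p.1.IsPeak i).card =
      catalan s := by
  rw [← card_dyckWord_semilength_eq_catalan, ← Finset.card_univ]
  symm
  refine Finset.card_bij (fun p _ => ⟨p.1.insertPeak i, by rw [semilength_insertPeak, p.2]⟩)
    ?_ ?_ ?_
  · intro p _
    simpa using isPeak_insertPeak (by rw [p.2]; exact hi)
  · intro p _ q _ h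
    exact Subtype.ext (insertPeak_injective (p.2.trans q.2.symm) (congrArg Subtype.val h))
  · intro p hp
    have hp : p.1.IsPeak i := by simpa using hp
    refine ⟨⟨p.1.erasePeak i hp, ?_⟩, Finset.mem_univ _, ?_⟩
    · have := semilength_erasePeak hp
      have := p.2
      omega
    · exact Subtype.ext (insertPeak_erasePeak hp)

-- Deleting the later peak leaves the earlier one in place, so insertion at `j` maps the words with
-- a peak at `i` onto a superset of those counted.
open scoped Classical in
theorem card_isPeak_and_isPeak_le {s i j : ℕ} (hi : i ≤ 2 * s) (hij : i + 2 ≤ j) :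
    (Finset.univ.filter fun p : {p : DyckWord // p.semilength = s + 2} =>
      p.1.IsPeak i ∧ p.1.IsPeak j).card ≤ catalan s := by
  rw [← card_isPeak hi]
  let f (p : {p : DyckWord // p.semilength = s + 1}) : {p : DyckWord // p.semilength = s + 2} :=
    ⟨p.1.insertPeak j, by rw [semilength_insertPeak, p.2]⟩
  refine (Finset.card_le_card ?_).trans (Finset.card_image_le (f := f))
  intro p hp
  obtain ⟨hpi, hpj⟩ : p.1.IsPeak i ∧ p.1.IsPeak j := by simpa using hp
  refine Finset.mem_image.2 ⟨⟨p.1.erasePeak j hpj, ?_⟩, ?_, Subtype.ext (insertPeak_erasePeak hpj)⟩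
  · have := semilength_erasePeak hpj
    have := p.2
    omega
  · simpa using hpi.erasePeak hpj hij

end DyckWord

/-! ### Matched pairs of parentheses -/

namespace DyckWord

theorem isPeak_iff_parenMatched {p : DyckWord} {i : ℕ} :
    p.IsPeak i ↔ ParenMatched p i (i + 1) := by
  constructor
  · intro h
    have hil := (List.getElem?_eq_some_iff.1 h.1).1
    refine ⟨p.toList.take i, p.toList.drop (i + 2), 0, ?_, ?_, ?_⟩
    · conv_lhs => rw [h.toList_eq]
      simp [nest, show (0 : DyckWord).toList = [] from rfl]
    · simp; omega
    · simp [show (0 : DyckWord).toList = [] from rfl]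
  · rintro ⟨l, r, q, h, rfl, hj⟩
    have hq : q.toList = [] := List.length_eq_zero_iff.1 (by omega)
    simp only [nest, hq] at h
    simp [IsPeak, h]

/-- Induction on the decomposition `U inside D outside`: the given `U` is the first letter or lies
in one of the two shorter words. -/
theorem exists_parenMatched {p : DyckWord} {i : ℕ} (h : p.toList[i]? = some U) :
    ∃ j, ParenMatched p i j := by
  induction hn : p.semilength using Nat.strong_induction_on generalizing p i with
  | _ n ih =>
  have hp : p ≠ 0 := by
    rintro rfl
    simp [show (0 : DyckWord).toList = [] from rfl] at h
  have hdec : p.toList = U :: (p.insidePart.toList ++ D :: p.outsidePart.toList) := by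
    conv_lhs => rw [← nest_insidePart_add_outsidePart hp]
    change p.insidePart.nest.toList ++ p.outsidePart.toList = _
    simp [nest]
  rcases i with _ | i
  · exact ⟨_, [], p.outsidePart.toList, p.insidePart, by rw [hdec]; simp [nest], rfl, rfl⟩
  rw [hdec, List.getElem?_cons_succ] at h
  rcases lt_or_ge i p.insidePart.toList.length with hi | hi
  · rw [List.getElem?_append_left hi] at h
    obtain ⟨j, l, r, q, hl, hil, hj⟩ := ih _ (hn ▸ semilength_insidePart_lt hp) h rfl
    refine ⟨j + 1, U :: l, r ++ D :: p.outsidePart.toList, q, ?_, by simp [hil], by omega⟩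
    rw [hdec, hl]; simp
  · rw [List.getElem?_append_right hi] at h
    obtain ⟨k, hk⟩ := Nat.exists_eq_add_of_le hi
    rcases k with _ | k
    · simp [hk] at h
    · rw [hk, Nat.add_sub_cancel_left, List.getElem?_cons_succ] at h
      obtain ⟨j, l, r, q, hl, hil, hj⟩ := ih _ (hn ▸ semilength_outsidePart_lt hp) h rfl
      refine ⟨_, U :: p.insidePart.toList ++ D :: l, r, q, ?_, ?_, rfl⟩
      · rw [hdec, hl]; simp
      · simp; omega

theorem getElem?_eq_U_of_parenMatched {p : DyckWord} {i j : ℕ} (h : ParenMatched p i j) :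
    p.toList[i]? = some U := by
  obtain ⟨l, r, q, h, rfl, -⟩ := h
  simp [h, nest]

/-- A Dyck word is determined by its semilength and its matched pairs. -/
theorem eq_of_parenMatched_iff {p q : DyckWord} (hs : p.semilength = q.semilength)
    (h : ∀ i j, ParenMatched p i j ↔ ParenMatched q i j) : p = q := by
  have hU (i : ℕ) : p.toList[i]? = some U ↔ q.toList[i]? = some U :=
    ⟨fun hi => (exists_parenMatched hi).elim
        fun j hj => getElem?_eq_U_of_parenMatched ((h i j).1 hj),
      fun hi => (exists_parenMatched hi).elim
        fun j hj => getElem?_eq_U_of_parenMatched ((h i j).2 hj)⟩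
  have hlen : p.toList.length = q.toList.length := by
    rw [← two_mul_semilength_eq_length, ← two_mul_semilength_eq_length, hs]
  refine DyckWord.ext (List.ext_getElem hlen fun i h₁ h₂ => ?_)
  have := hU i
  rw [List.getElem?_eq_getElem h₁, List.getElem?_eq_getElem h₂, Option.some_inj,
    Option.some_inj] at this
  cases hp : p.toList[i] <;> cases hq : q.toList[i] <;> simp_all

end DyckWord

/-! ### Counting meander graphs -/

theorem meanderGraph_injective (s : ℕ) :
    Function.Injective fun x : {p : DyckWord // p.semilength = s} ×
      {p : DyckWord // p.semilength = s} => meanderGraph s x.1 x.2 := by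
  rintro ⟨P, Q⟩ ⟨P', Q'⟩ h
  have hE (e : MeanderEdge) : e.IsEdgeOf s P Q ↔ e.IsEdgeOf s P' Q' := by
    -- A label fixes its own ends, so the link relation at these ends detects whether the label is
    -- an edge.
    obtain ⟨⟨x, y⟩, hxy⟩ : ∃ z : ℕ × ℕ, s(z.1, z.2) = e.ends s :=
      ⟨(e.ends s).out, Quot.out_eq _⟩
    have h' : (meanderGraph s P Q).IsLink e x y ↔ (meanderGraph s P' Q').IsLink e x y := by
      simp only at h
      rw [h]
    simpa [meanderGraph, hxy] using h'
  refine Prod.ext (Subtype.ext ?_) (Subtype.ext ?_)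
  · refine DyckWord.eq_of_parenMatched_iff (P.2.trans P'.2.symm) fun i j => ?_
    simpa [MeanderEdge.IsEdgeOf] using hE (.upper (i + 1) (j + 1))
  · exact DyckWord.eq_of_parenMatched_iff (Q.2.trans Q'.2.symm) fun i j => hE (.lower i j)

theorem meanderGraphs_eq_range (s : ℕ) : meanderGraphs s =
    Set.range fun x : {p : DyckWord // p.semilength = s} × {p : DyckWord // p.semilength = s} =>
      meanderGraph s x.1 x.2 := by
  ext Γ
  simp [meanderGraphs, eq_comm]

theorem ncard_meanderGraphs (s : ℕ) : (meanderGraphs s).ncard = catalan s ^ 2 := by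
  rw [meanderGraphs_eq_range, ← Set.image_univ,
    Set.ncard_image_of_injective _ (meanderGraph_injective s), Set.ncard_univ,
    Nat.card_eq_fintype_card, Fintype.card_prod, DyckWord.card_dyckWord_semilength_eq_catalan, sq]

/-- Letter `i` of `P` and letter `i + 1` of `Q` both sit at the point `i + 1`; both ends are genuine
vertices, so `toVertex` fixes them. -/
theorem hasPiercedCircleAt_of_isPeak {s : ℕ} {P Q : {p : DyckWord // p.semilength = s}} {i : ℕ}
    (hP : P.1.IsPeak i) (hQ : Q.1.IsPeak (i + 1)) :
    HasPiercedCircleAt (meanderGraph s P Q) (i + 1) := by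
  have hl := (List.getElem?_eq_some_iff.1 hQ.2).1
  rw [← DyckWord.two_mul_semilength_eq_length, Q.2] at hl
  have h1 : MeanderEdge.toVertex s (i + 1) = i + 1 := by unfold MeanderEdge.toVertex; omega
  have h2 : MeanderEdge.toVertex s (i + 1 + 1) = i + 1 + 1 := by
    unfold MeanderEdge.toVertex; omega
  refine ⟨⟨⟨i, i + 1, DyckWord.isPeak_iff_parenMatched.1 hP, rfl, rfl⟩, ?_⟩,
    ⟨DyckWord.isPeak_iff_parenMatched.1 hQ, ?_⟩⟩ <;> simp only [MeanderEdge.ends, h1, h2]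

/-- Needed because `ncard` is also `0` on infinite sets. -/
theorem finite_setOf_hasPiercedCircleAt {s : ℕ} (P Q : {p : DyckWord // p.semilength = s}) :
    {i | HasPiercedCircleAt (meanderGraph s P Q) i}.Finite :=
  (Set.finite_lt_nat (2 * s)).subset fun _ hi => hi.1.left_mem.2

open scoped Classical in
theorem meanderE_zero_le (s : ℕ) : meanderE s 0 ≤
    (Finset.univ.filter fun x : {p : DyckWord // p.semilength = s} ×
      {p : DyckWord // p.semilength = s} => ∀ i, ¬ (x.1.1.IsPeak i ∧ x.2.1.IsPeak (i + 1))).card := by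
  rw [← Set.ncard_coe_finset]
  refine (Set.ncard_le_ncard ?_ ((Finset.finite_toSet _).image _)).trans
    (Set.ncard_image_le (f := fun x => meanderGraph s x.1 x.2) (Finset.finite_toSet _))
  rintro Γ ⟨⟨P, Q, rfl⟩, h0⟩
  refine ⟨(P, Q), ?_, rfl⟩
  simp only [Finset.coe_filter, Finset.mem_univ, true_and, Set.mem_ofPred_eq]
  rintro i ⟨hP, hQ⟩
  rw [numPiercedCircles, Set.ncard_eq_zero (finite_setOf_hasPiercedCircleAt P Q)] at h0
  exact (h0 ▸ hasPiercedCircleAt_of_isPeak hP hQ : i + 1 ∈ (∅ : Set ℕ))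

/-! ### Second moment method -/

open scoped Classical in
/-- Second moment bound for the number of points that lie in none of `n` sets of equal size with
small pairwise intersections. -/
theorem card_avoiding_mul_le {α : Type*} [Fintype α] (n : ℕ) (A : ℕ → α → Prop) (a b : ℕ)
    (ha : ∀ i < n, (Finset.univ.filter (A i)).card = a)
    (hb : ∀ i < n, ∀ j < n, i < j → (Finset.univ.filter fun x => A i x ∧ A j x).card ≤ b) :
    ((Finset.univ.filter fun x => ∀ i, ¬ A i x).card : ℝ) * (n * a) ^ 2 ≤
      Fintype.card α * (Fintype.card α * (n * a + n ^ 2 * b) - (n * a) ^ 2) := by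
  set N : ℝ := (Fintype.card α : ℝ)
  let X (x : α) : ℝ := ∑ i ∈ Finset.range n, if A i x then 1 else 0
  have h1 : ∑ x, X x = n * a := by
    simp only [X]
    rw [Finset.sum_comm, Finset.sum_congr rfl (g := fun _ => (a : ℝ))]
    · simp
    · intro i hi
      rw [Finset.sum_boole, ha i (Finset.mem_range.1 hi)]
  have hpair (i j : ℕ) (hi : i < n) (hj : j < n) :
      ∑ x, (if A i x then (1 : ℝ) else 0) * (if A j x then 1 else 0) ≤
        (if i = j then (a : ℝ) else 0) + b := by
    have he (x : α) : (if A i x then (1 : ℝ) else 0) * (if A j x then 1 else 0) =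
        if A i x ∧ A j x then 1 else 0 := by
      by_cases h : A i x <;> by_cases h' : A j x <;> simp [h, h']
    simp only [he, Finset.sum_boole]
    rcases lt_trichotomy i j with h | rfl | h
    · simpa [h.ne] using hb i hi j hj h
    · simp [ha i hi]
    · simpa [h.ne', and_comm] using hb j hj i hi h
  have h2 : ∑ x, X x ^ 2 ≤ n * a + n ^ 2 * b := by
    calc ∑ x, X x ^ 2 = ∑ i ∈ Finset.range n, ∑ j ∈ Finset.range n,
          ∑ x, (if A i x then (1 : ℝ) else 0) * (if A j x then 1 else 0) := by
          simp only [X, sq, Finset.sum_mul_sum]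
          rw [Finset.sum_comm]
          exact Finset.sum_congr rfl fun i _ => Finset.sum_comm
      _ ≤ ∑ i ∈ Finset.range n, ∑ j ∈ Finset.range n, ((if i = j then (a : ℝ) else 0) + b) :=
          Finset.sum_le_sum fun i hi => Finset.sum_le_sum fun j hj =>
            hpair i j (Finset.mem_range.1 hi) (Finset.mem_range.1 hj)
      _ = ∑ i ∈ Finset.range n, ((a : ℝ) + n * b) := by
          refine Finset.sum_congr rfl fun i hi => ?_
          rw [Finset.sum_add_distrib, Finset.sum_ite_eq, if_pos hi]
          simp
      _ = n * a + n ^ 2 * b := by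
          rw [Finset.sum_const, Finset.card_range, nsmul_eq_mul]; ring
  have h3 : ∑ x, (N * X x - n * a) ^ 2 = N * (N * ∑ x, X x ^ 2 - (n * a) ^ 2) := by
    have he (x : α) : (N * X x - n * a) ^ 2 =
        N ^ 2 * X x ^ 2 - 2 * N * (n * a) * X x + (n * a) ^ 2 := by ring
    simp only [he, Finset.sum_add_distrib, Finset.sum_sub_distrib, ← Finset.mul_sum, h1,
      Finset.sum_const, Finset.card_univ, nsmul_eq_mul]
    ring
  -- Chebyshev: a point with `X x = 0` contributes exactly `(n * a) ^ 2` to the scaled variance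
  -- `h3`.
  calc _ = ∑ x ∈ Finset.univ.filter fun x => ∀ i, ¬ A i x, (N * X x - n * a) ^ 2 := by
        rw [Finset.sum_congr rfl (g := fun _ => ((n : ℝ) * a) ^ 2)]
        · rw [Finset.sum_const, nsmul_eq_mul]
        · intro x hx
          have hx : ∀ i, ¬ A i x := by simpa using hx
          simp [X, hx]
    _ ≤ ∑ x, (N * X x - n * a) ^ 2 :=
        Finset.sum_le_sum_of_subset_of_nonneg (Finset.filter_subset _ _)
          fun _ _ _ => sq_nonneg _
    _ ≤ _ := by
        rw [h3]
        have hN : 0 ≤ N := Nat.cast_nonneg _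
        gcongr

/-! ### Ratios of Catalan numbers -/

theorem catalan_pos (n : ℕ) : 0 < catalan n :=
  Nat.pos_of_mul_pos_left (a := n + 1)
    (by rw [succ_mul_catalan_eq_centralBinom]; exact Nat.centralBinom_pos n)

theorem catalan_succ_div_catalan (n : ℕ) :
    (catalan (n + 1) : ℝ) / catalan n = (4 * n + 2) / (n + 2) := by
  have h0 := succ_mul_catalan_eq_centralBinom n
  have h1 := succ_mul_catalan_eq_centralBinom (n + 1)
  have h2 := Nat.succ_mul_centralBinom_succ n
  rw [← h0, ← h1] at h2
  have h3 : ((n : ℝ) + 1) * (((n + 2) * catalan (n + 1)) - (4 * n + 2) * catalan n) = 0 := by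
    have := congrArg (Nat.cast (R := ℝ)) h2
    push_cast at this
    linear_combination this
  have hc : (catalan n : ℝ) ≠ 0 := by exact_mod_cast (catalan_pos n).ne'
  have hn : (n : ℝ) + 1 ≠ 0 := by positivity
  rw [div_eq_div_iff hc (by positivity)]
  linear_combination (mul_eq_zero.1 h3).resolve_left hn

theorem tendsto_catalan_succ_div_catalan :
    Filter.Tendsto (fun n : ℕ => (catalan (n + 1) : ℝ) / catalan n) Filter.atTop (nhds 4) := by
  have h : Filter.Tendsto (fun n : ℕ => (4 : ℝ) - 6 / ((n + 2 : ℕ) : ℝ)) Filter.atTop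
      (nhds (4 - 0)) :=
    tendsto_const_nhds.sub ((tendsto_const_div_atTop_nhds_zero_nat (6 : ℝ)).comp
      (Filter.tendsto_add_atTop_nat 2))
  rw [sub_zero] at h
  refine h.congr fun n => ?_
  rw [catalan_succ_div_catalan]
  push_cast
  field_simp
  ring

/-! ### The bound and its limit -/

theorem Finset.card_filter_univ_prod {α β : Type*} [Fintype α] [Fintype β] {R : α × β → Prop}
    {p : α → Prop} {q : β → Prop} {_ : DecidablePred R} [DecidablePred p] [DecidablePred q]
    (h : ∀ x, R x ↔ p x.1 ∧ q x.2) :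
    (Finset.univ.filter R).card = (Finset.univ.filter p).card * (Finset.univ.filter q).card := by
  rw [← Finset.card_product]
  congr 1
  ext x
  simp [h]

theorem meanderE_zero_div_le (t : ℕ) :
    (meanderE (t + 2) 0 : ℝ) / (catalan (t + 2) : ℝ) ^ 2 ≤
      ((catalan (t + 2) : ℝ) / catalan (t + 1)) ^ 2 / ((2 * t + 2 : ℕ) : ℝ) +
        (((catalan (t + 2) : ℝ) / catalan (t + 1)) / ((catalan (t + 1) : ℝ) / catalan t)) ^ 2 -
          1 := by
  classical
  have key := card_avoiding_mul_le (α := {p : DyckWord // p.semilength = t + 2} ×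
      {p : DyckWord // p.semilength = t + 2}) (2 * t + 2)
    (fun i x => x.1.1.IsPeak i ∧ x.2.1.IsPeak (i + 1)) (catalan (t + 1) ^ 2) (catalan t ^ 2)
    (fun i hi => by
      refine (Finset.card_filter_univ_prod
        (p := fun p : {p : DyckWord // p.semilength = t + 2} => p.1.IsPeak i)
        (q := fun p : {p : DyckWord // p.semilength = t + 2} => p.1.IsPeak (i + 1))
        (fun _ => Iff.rfl)).trans ?_
      rw [DyckWord.card_isPeak (by omega), DyckWord.card_isPeak (by omega), sq])
    (fun i hi j hj hij => by
      refine (Finset.card_filter_univ_prod (p := fun p => p.1.IsPeak i ∧ p.1.IsPeak j)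
        (q := fun p => p.1.IsPeak (i + 1) ∧ p.1.IsPeak (j + 1)) (fun _ => by tauto)).trans_le ?_
      -- Peaks cannot start at consecutive positions, so for `j = i + 1` the count is zero.
      rcases Nat.lt_or_ge j (i + 2) with h | h
      · obtain rfl : j = i + 1 := by omega
        rw [Finset.filter_false_of_mem
          (fun p _ => fun hp => DyckWord.not_isPeak_succ hp.1 hp.2)]
        simp
      · rw [sq]
        exact Nat.mul_le_mul (DyckWord.card_isPeak_and_isPeak_le (by omega) h)
          (DyckWord.card_isPeak_and_isPeak_le (by omega) (by omega)))
  have hle : (meanderE (t + 2) 0 : ℝ) ≤ _ := Nat.cast_le.2 (meanderE_zero_le (t + 2))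
  rw [Fintype.card_prod, DyckWord.card_dyckWord_semilength_eq_catalan] at key
  have h0 : (0 : ℝ) < catalan t := by exact_mod_cast catalan_pos t
  have h1 : (0 : ℝ) < catalan (t + 1) := by exact_mod_cast catalan_pos (t + 1)
  have h2 : (0 : ℝ) < catalan (t + 2) := by exact_mod_cast catalan_pos (t + 2)
  have hn : (0 : ℝ) < ((2 * t + 2 : ℕ) : ℝ) := by positivity
  have key := (mul_le_mul_of_nonneg_right hle (sq_nonneg _)).trans key
  rw [Nat.cast_mul, Nat.cast_pow, Nat.cast_pow, ← div_le_iff₀' (by positivity)] at key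
  generalize ((2 * t + 2 : ℕ) : ℝ) = n at *
  generalize (catalan t : ℝ) = c₀ at *
  generalize (catalan (t + 1) : ℝ) = c₁ at *
  generalize (catalan (t + 2) : ℝ) = c₂ at *
  refine le_of_mul_le_mul_right ?_ (show 0 < (n * c₁ ^ 2) ^ 2 by positivity)
  calc _ = _ := by ring
    _ ≤ _ := key
    _ = _ := by field_simp

theorem tendsto_meanderE_zero_div_catalan_sq :
    Filter.Tendsto (fun s : ℕ => (meanderE s 0 : ℝ) / (catalan s : ℝ) ^ 2)
      Filter.atTop (nhds 0) := by
  rw [← Filter.tendsto_add_atTop_iff_nat 2]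
  have hr := tendsto_catalan_succ_div_catalan
  have hr' := hr.comp (Filter.tendsto_add_atTop_nat 1)
  have hn : Filter.Tendsto (fun t : ℕ => ((2 * t + 2 : ℕ) : ℝ)) Filter.atTop Filter.atTop :=
    tendsto_natCast_atTop_atTop.comp
      (Filter.tendsto_atTop_mono (fun t => show t ≤ 2 * t + 2 by omega) Filter.tendsto_id)
  -- The limit is `0 + (4 / 4) ^ 2 - 1 = 0`.
  have hlim := (((hr'.pow 2).div_atTop hn).add ((hr'.div hr (by norm_num)).pow 2)).sub_const 1
  norm_num only at hlim
  exact squeeze_zero (fun t => by positivity) meanderE_zero_div_le hlim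

theorem proposition4p3 :
    Filter.Tendsto (fun s : ℕ => (meanderE s 0 : ℝ) / ((meanderGraphs s).ncard : ℝ))
        Filter.atTop (nhds 0) ∧
      Filter.Tendsto (fun s : ℕ => (meanderE s 0 : ℝ) / (catalan s : ℝ) ^ 2)
        Filter.atTop (nhds 0) := by
  refine ⟨?_, tendsto_meanderE_zero_div_catalan_sq⟩
  simpa only [ncard_meanderGraphs, Nat.cast_pow] using tendsto_meanderE_zero_div_catalan_sq
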